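/- Let $k\ge 1$ and let $J^k(\mathbb R)$ be the jet space $\mathbb R^{k+2}$ with coordinates $(x,u_k,\ldots,u_0)$. A curve is horizontal if it is absolutely continuous as a map into $\mathbb R^{k+2}$ and its derivative is annihilated almost everywhere by the contact forms $du_j-u_{j+1}\,dx$, $0\le j\le k-1$; the length of a horizontal curve $\gamma=(x,u_k,\ldots,u_0)$ on $[a,b]$ is $\int_a^b\sqrt{x'(s)^2+u_k'(s)^2}\,ds$. Equip $J^k(\mathbb R)$ with the Carnot--Carathéodory metric $d_{cc}$, where $d_{cc}(p,q)$ is the infimum of the lengths of the horizontal curves joining $p$ to $q$. **Theorem.** For each $t\in\mathbb R$ and each $0\le\beta\le\frac{(k+1)(k+2)}{2}$ there is a compact set $E_{t,\beta}$ contained in the hyperplane $\{x=t\}=\{(x,u_k,\ldots,u_0)\in J^k(\mathbb R): x=t\}$ such that, with respect to $d_{cc}$, $$\dim_{\mathcal H}E_{t,\beta}=\beta .$$ Moreover, the set can be taken of the form $$E_{t,\beta}=\{t\}\times[0,1]^{j-1}\times\widetilde E\times\{0\}^{k-j+1}$$ for some $1\le j\le k+1$ and some compact set $\widetilde E\subset\mathbb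 R$ with $\frac{j(j-1)}{2}+j\dim_{\mathcal H}\widetilde E=\beta$ (where $\dim_{\mathcal H}\widetilde E$ is taken with respect to the usual metric of $\mathbb R$). -/

import Mathlib

open scoped ENNReal

/-! ### The jet space `J^k(ℝ)` -/

/-- The jet space `J^k(ℝ) = ℝ^{k+2}`. A point `(x, u_k, …, u_0)` is stored as its first coordinate
`x` and the function `j ↦ u_j`, `0 ≤ j ≤ k`. -/
@[ext]
structure JetSpace (k : ℕ) where
  x : ℝ
  u : Fin (k + 1) → ℝ

namespace JetSpace

variable {k : ℕ}

/-- `γ` restricted to `[a, b]` is a horizontal curve: it is absolutely continuous as a map into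
`ℝ^{k+2}` and for almost every `s` its derivative is annihilated by the contact forms
`du_j - u_{j+1} dx`, `0 ≤ j ≤ k - 1`. -/
structure IsHorizontal (γ : ℝ → JetSpace k) (a b : ℝ) : Prop where
  ac_x : AbsolutelyContinuousOnInterval (fun s => (γ s).x) a b
  ac_u : ∀ j, AbsolutelyContinuousOnInterval (fun s => (γ s).u j) a b
  contact : ∀ j : Fin k, ∀ᵐ s ∂(MeasureTheory.volume.restrict (Set.Icc a b)),
    deriv (fun r => (γ r).u j.castSucc) s = (γ s).u j.succ * deriv (fun r => (γ r).x) s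

/-- The speed of a horizontal curve for the sub-Riemannian metric in which the horizontal frame
`X = ∂_x + u_k ∂_{u_{k-1}} + ⋯ + u_1 ∂_{u_0}`, `∂_{u_k}` is orthonormal: a horizontal velocity
equals `x' X + u_k' ∂_{u_k}`. -/
noncomputable def speed (γ : ℝ → JetSpace k) (s : ℝ) : ℝ :=
  √((deriv (fun r => (γ r).x) s) ^ 2 + (deriv (fun r => (γ r).u (Fin.last k)) s) ^ 2)

/-- The length of a horizontal curve on `[a, b]`. -/
noncomputable def length (γ : ℝ → JetSpace k) (a b : ℝ) : ℝ≥0∞ :=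
  ∫⁻ s in Set.Icc a b, ENNReal.ofReal (speed γ s)

/-- The Carnot–Carathéodory distance: the infimum of the lengths of the horizontal curves from `p`
to `q`. -/
noncomputable def ccDist (p q : JetSpace k) : ℝ≥0∞ :=
  ⨅ (γ : ℝ → JetSpace k) (a : ℝ) (b : ℝ)
    (_ : a ≤ b ∧ IsHorizontal γ a b ∧ γ a = p ∧ γ b = q), length γ a b

/-! ### The Carnot–Carathéodory distance is a distance -/

theorem ccDist_le {γ : ℝ → JetSpace k} {a b : ℝ} (hab : a ≤ b) (hγ : IsHorizontal γ a b) :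
    ccDist (γ a) (γ b) ≤ length γ a b :=
  iInf_le_of_le γ <| iInf_le_of_le a <| iInf_le_of_le b <| iInf_le_of_le ⟨hab, hγ, rfl, rfl⟩ le_rfl

theorem exists_of_ccDist_lt {p q : JetSpace k} {c : ℝ≥0∞} (h : ccDist p q < c) :
    ∃ (γ : ℝ → JetSpace k) (a b : ℝ), a ≤ b ∧ IsHorizontal γ a b ∧ γ a = p ∧ γ b = q ∧
      length γ a b < c := by
  simp only [ccDist, iInf_lt_iff] at h
  obtain ⟨γ, a, b, ⟨h1, h2, h3, h4⟩, h5⟩ := h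
  exact ⟨γ, a, b, h1, h2, h3, h4, h5⟩

theorem ccDist_self (p : JetSpace k) : ccDist p p = 0 := by
  have h : IsHorizontal (fun _ : ℝ => p) 0 0 :=
    ⟨contDiffOn_const.absolutelyContinuousOnInterval,
      fun j => contDiffOn_const.absolutelyContinuousOnInterval, fun j => by simp⟩
  have := ccDist_le le_rfl h
  simpa [length] using this

theorem ac_of_eq_integral {f g : ℝ → ℝ} {a b : ℝ} (hab : a ≤ b)
    (hg : IntervalIntegrable g MeasureTheory.volume a b)
    (h : ∀ x ∈ Set.Icc a b, f x = f a + ∫ t in a..x, g t) :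
    AbsolutelyContinuousOnInterval f a b := by
  have h1 : AbsolutelyContinuousOnInterval (fun x => f a + ∫ t in a..x, g t) a b :=
    (contDiffOn_const.absolutelyContinuousOnInterval).fun_add
      (hg.absolutelyContinuousOnInterval_intervalIntegral (by simp))
  rw [absolutelyContinuousOnInterval_iff] at h1 ⊢
  intro ε hε
  obtain ⟨δ, hδ, H⟩ := h1 ε hε
  refine ⟨δ, hδ, fun E hE hE' => ?_⟩
  convert H E hE hE' using 1
  refine Finset.sum_congr rfl fun i hi => ?_
  have := hE.1 i hi
  rw [Set.uIcc_of_le hab] at this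
  rw [h _ this.1, h _ this.2]

theorem ac_eq_integral {f : ℝ → ℝ} {a b : ℝ} (hf : AbsolutelyContinuousOnInterval f a b)
    {x : ℝ} (hx : x ∈ Set.Icc a b) : f x = f a + ∫ t in a..x, deriv f t := by
  have hab : a ≤ b := hx.1.trans hx.2
  have : AbsolutelyContinuousOnInterval f a x := hf.mono (by
    rw [Set.uIcc_of_le hab, Set.uIcc_of_le hx.1]
    exact Set.Icc_subset_Icc_right hx.2)
  rw [this.integral_deriv_eq_sub]
  ring

theorem ac_congr {f g : ℝ → ℝ} {a b : ℝ} (hab : a ≤ b) (h : AbsolutelyContinuousOnInterval f a b)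
    (hfg : ∀ x ∈ Set.Icc a b, g x = f x) : AbsolutelyContinuousOnInterval g a b := by
  refine ac_of_eq_integral hab h.intervalIntegrable_deriv fun x hx => ?_
  rw [hfg x hx, hfg a ⟨le_rfl, hab⟩, ac_eq_integral h hx]

theorem ac_trans {f : ℝ → ℝ} {a b c : ℝ} (hab : a ≤ b) (hbc : b ≤ c)
    (h1 : AbsolutelyContinuousOnInterval f a b) (h2 : AbsolutelyContinuousOnInterval f b c) :
    AbsolutelyContinuousOnInterval f a c := by
  have i1 := h1.intervalIntegrable_deriv
  have i2 := h2.intervalIntegrable_deriv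
  refine ac_of_eq_integral (hab.trans hbc) (i1.trans i2) fun x hx => ?_
  rcases le_total x b with hxb | hxb
  · exact ac_eq_integral h1 ⟨hx.1, hxb⟩
  · have i3 : IntervalIntegrable (deriv f) MeasureTheory.volume b x := i2.mono_set (by
      rw [Set.uIcc_of_le hbc, Set.uIcc_of_le hxb]; exact Set.Icc_subset_Icc_right hx.2)
    rw [← intervalIntegral.integral_add_adjacent_intervals i1 i3, ← add_assoc,
      ← ac_eq_integral h1 ⟨hab, le_rfl⟩, ← ac_eq_integral h2 ⟨hxb, hx.2⟩]

theorem ac_reflect {f : ℝ → ℝ} {a b : ℝ} (hab : a ≤ b) (h : AbsolutelyContinuousOnInterval f a b)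
    (c : ℝ) : AbsolutelyContinuousOnInterval (fun s => f (c - s)) (c - b) (c - a) := by
  have i := ((h.intervalIntegrable_deriv).comp_sub_left c).symm.neg
  refine ac_of_eq_integral (by linarith) i fun x hx => ?_
  have hx' : c - x ∈ Set.Icc a b := ⟨by linarith [hx.2], by linarith [hx.1]⟩
  have e1 := ac_eq_integral h hx'
  have e2 := ac_eq_integral h (⟨hab, le_rfl⟩ : b ∈ Set.Icc a b)
  have i1 : IntervalIntegrable (deriv f) MeasureTheory.volume a (c - x) :=
    h.intervalIntegrable_deriv.mono_set (by
      rw [Set.uIcc_of_le hab, Set.uIcc_of_le hx'.1]; exact Set.Icc_subset_Icc_right hx'.2)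
  have i2 : IntervalIntegrable (deriv f) MeasureTheory.volume (c - x) b :=
    h.intervalIntegrable_deriv.mono_set (by
      rw [Set.uIcc_of_le hab, Set.uIcc_of_le hx'.2]; exact Set.Icc_subset_Icc_left hx'.1)
  have e3 := intervalIntegral.integral_add_adjacent_intervals i1 i2
  have e4 : ∫ t in (c - b)..x, (-fun s => deriv f (c - s)) t = -∫ t in (c - x)..b, deriv f t := by
    simp [intervalIntegral.integral_neg]
  rw [e4, sub_sub_cancel]
  linarith

theorem mp_reflect (a b c : ℝ) : MeasureTheory.MeasurePreserving (fun s : ℝ => c - s)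
    (MeasureTheory.volume.restrict (Set.Icc (c - b) (c - a)))
    (MeasureTheory.volume.restrict (Set.Icc a b)) := by
  have := (MeasureTheory.Measure.measurePreserving_sub_left (MeasureTheory.volume : MeasureTheory.Measure ℝ)
    c).restrict_preimage (measurableSet_Icc (a := a) (b := b))
  simpa using this

theorem IsHorizontal.reflect {γ : ℝ → JetSpace k} {a b : ℝ} (hab : a ≤ b)
    (h : IsHorizontal γ a b) (c : ℝ) :
    IsHorizontal (fun s => γ (c - s)) (c - b) (c - a) where
  ac_x := ac_reflect hab h.ac_x c
  ac_u j := ac_reflect hab (h.ac_u j) c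
  contact j := by
    filter_upwards [(mp_reflect a b c).quasiMeasurePreserving.ae (h.contact j)] with s hs
    have e1 := deriv_comp_const_sub (f := fun r => (γ r).u j.castSucc) c s
    have e2 := deriv_comp_const_sub (f := fun r => (γ r).x) c s
    rw [e1, e2, hs]
    ring

theorem length_reflect (γ : ℝ → JetSpace k) (a b c : ℝ) :
    length (fun s => γ (c - s)) (c - b) (c - a) = length γ a b := by
  have h := (mp_reflect a b c).lintegral_comp_emb
    (Homeomorph.subLeft c).measurableEmbedding (fun s => ENNReal.ofReal (speed γ s))
  rw [length, length, ← h]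
  congr 1
  ext s
  have e1 := deriv_comp_const_sub (f := fun r => (γ r).u (Fin.last k)) c s
  have e2 := deriv_comp_const_sub (f := fun r => (γ r).x) c s
  simp only [speed, e1, e2, neg_sq]

theorem ccDist_comm_le (p q : JetSpace k) : ccDist q p ≤ ccDist p q := by
  refine le_of_forall_gt fun c hc => ?_
  obtain ⟨γ, a, b, hab, hγ, rfl, rfl, hl⟩ := exists_of_ccDist_lt hc
  have := ccDist_le (by linarith) (hγ.reflect hab 0)
  rw [length_reflect] at this
  simp only [sub_sub_cancel] at this
  exact this.trans_lt hl

theorem IsHorizontal.congr {γ η : ℝ → JetSpace k} {a b : ℝ} (hab : a ≤ b)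
    (h : IsHorizontal γ a b) (e : ∀ s ∈ Set.Icc a b, η s = γ s) : IsHorizontal η a b where
  ac_x := ac_congr hab h.ac_x fun s hs => by rw [e s hs]
  ac_u j := ac_congr hab (h.ac_u j) fun s hs => by rw [e s hs]
  contact j := by
    have h0 := h.contact j
    rw [← MeasureTheory.restrict_Ioo_eq_restrict_Icc,
      MeasureTheory.ae_restrict_iff' measurableSet_Ioo] at h0 ⊢
    filter_upwards [h0] with s hs hs'
    have e' : η =ᶠ[nhds s] γ := by
      filter_upwards [isOpen_Ioo.mem_nhds hs'] with r hr using e r ⟨hr.1.le, hr.2.le⟩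
    have e1 : (fun r => (η r).u j.castSucc) =ᶠ[nhds s] fun r => (γ r).u j.castSucc :=
      e'.fun_comp fun p => p.u j.castSucc
    have e2 : (fun r => (η r).x) =ᶠ[nhds s] fun r => (γ r).x := e'.fun_comp fun p => p.x
    rw [e1.deriv_eq, e2.deriv_eq, hs hs', e'.eq_of_nhds]

theorem length_congr {γ η : ℝ → JetSpace k} {a b : ℝ}
    (e : ∀ s ∈ Set.Icc a b, η s = γ s) : length η a b = length γ a b := by
  rw [length, length, ← MeasureTheory.restrict_Ioo_eq_restrict_Icc]
  refine MeasureTheory.setLIntegral_congr_fun measurableSet_Ioo fun s hs => ?_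
  have e' : η =ᶠ[nhds s] γ := by
    filter_upwards [isOpen_Ioo.mem_nhds hs] with r hr using e r ⟨hr.1.le, hr.2.le⟩
  have e1 : (fun r => (η r).u (Fin.last k)) =ᶠ[nhds s] fun r => (γ r).u (Fin.last k) :=
    e'.fun_comp fun p => p.u (Fin.last k)
  have e2 : (fun r => (η r).x) =ᶠ[nhds s] fun r => (γ r).x := e'.fun_comp fun p => p.x
  simp only [speed, e1.deriv_eq, e2.deriv_eq]

theorem IsHorizontal.trans {γ : ℝ → JetSpace k} {a b c : ℝ} (hab : a ≤ b) (hbc : b ≤ c)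
    (h1 : IsHorizontal γ a b) (h2 : IsHorizontal γ b c) : IsHorizontal γ a c where
  ac_x := ac_trans hab hbc h1.ac_x h2.ac_x
  ac_u j := ac_trans hab hbc (h1.ac_u j) (h2.ac_u j)
  contact j := by
    rw [← Set.Icc_union_Icc_eq_Icc hab hbc, MeasureTheory.ae_restrict_union_iff]
    exact ⟨h1.contact j, h2.contact j⟩

theorem length_trans_le (γ : ℝ → JetSpace k) {a b c : ℝ} (hab : a ≤ b) (hbc : b ≤ c) :
    length γ a c ≤ length γ a b + length γ b c := by
  rw [length, ← Set.Icc_union_Icc_eq_Icc hab hbc]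
  exact MeasureTheory.lintegral_union_le _ _ _

theorem ccDist_triangle (p q r : JetSpace k) : ccDist p r ≤ ccDist p q + ccDist q r := by
  refine le_of_forall_gt fun m hm => ?_
  obtain ⟨m₁, h1, m₂, h2, hm'⟩ : ∃ m₁ > ccDist p q, ∃ m₂ > ccDist q r, m₁ + m₂ < m :=
    ENNReal.exists_add_lt_of_add_lt hm
  obtain ⟨γ, a, b, hab, hγ, rfl, rfl, hl⟩ := exists_of_ccDist_lt h1
  obtain ⟨η, c, d, hcd, hη, hq, rfl, hl'⟩ := exists_of_ccDist_lt h2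
  -- translate the second curve so that it starts at time `b`
  obtain ⟨η', hη', e1, e2, e3⟩ : ∃ η' : ℝ → JetSpace k, IsHorizontal η' b (b + (d - c)) ∧
      η' b = η c ∧ η' (b + (d - c)) = η d ∧ length η' b (b + (d - c)) = length η c d := by
    have A := (hη.reflect hcd 0).reflect (by linarith) (b - c)
    have B := length_reflect (fun s => η (0 - s)) (0 - d) (0 - c) (b - c)
    rw [length_reflect] at B
    have t1 : b - c - (0 - c) = b := by ring
    have t2 : b - c - (0 - d) = b + (d - c) := by ring
    rw [t1, t2] at A B
    exact ⟨_, A, by simp, by simp, B⟩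
  let ζ : ℝ → JetSpace k := fun s => if s ≤ b then γ s else η' s
  have z1 : ∀ s ∈ Set.Icc a b, ζ s = γ s := fun s hs => if_pos hs.2
  have z2 : ∀ s ∈ Set.Icc b (b + (d - c)), ζ s = η' s := fun s hs => by
    rcases hs.1.eq_or_lt with h | h
    · subst h
      simp [ζ, e1, hq]
    · exact if_neg h.not_ge
  have hbd : b ≤ b + (d - c) := by linarith
  have hζ := (hγ.congr hab z1).trans hab hbd (hη'.congr hbd z2)
  have := (ccDist_le (hab.trans hbd) hζ).trans (length_trans_le ζ hab hbd)
  rw [z1 a ⟨le_rfl, hab⟩, z2 _ ⟨hbd, le_rfl⟩, e2, length_congr z1, length_congr z2, e3] at this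
  exact this.trans_lt ((ENNReal.add_lt_add hl hl').trans hm')

theorem abs_deriv_x_le (γ : ℝ → JetSpace k) (s : ℝ) :
    |deriv (fun r => (γ r).x) s| ≤ speed γ s :=
  Real.abs_le_sqrt (by linarith [sq_nonneg (deriv (fun r => (γ r).u (Fin.last k)) s)])

theorem abs_deriv_u_le (γ : ℝ → JetSpace k) (s : ℝ) :
    |deriv (fun r => (γ r).u (Fin.last k)) s| ≤ speed γ s :=
  Real.abs_le_sqrt (by linarith [sq_nonneg (deriv (fun r => (γ r).x) s)])

theorem abs_sub_le_of_deriv_le {f : ℝ → ℝ} {γ : ℝ → JetSpace k} {a b M ε : ℝ} (hM : 0 ≤ M)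
    (hε : 0 ≤ ε) (hf : AbsolutelyContinuousOnInterval f a b)
    (hd : ∀ᵐ s ∂(MeasureTheory.volume.restrict (Set.Icc a b)), |deriv f s| ≤ M * speed γ s)
    (hl : length γ a b ≤ ENNReal.ofReal ε) {x : ℝ} (hx : x ∈ Set.Icc a b) :
    |f x - f a| ≤ M * ε := by
  rw [ac_eq_integral hf hx, add_sub_cancel_left, intervalIntegral.integral_of_le hx.1,
    ← Real.norm_eq_abs]
  have h1 : ENNReal.ofReal ‖∫ t in Set.Ioc a x, deriv f t‖ ≤ ENNReal.ofReal (M * ε) := by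
    rw [ofReal_norm]
    calc _ ≤ ∫⁻ t in Set.Ioc a x, ‖deriv f t‖ₑ := MeasureTheory.enorm_integral_le_lintegral_enorm _
      _ ≤ ∫⁻ t in Set.Icc a b, ‖deriv f t‖ₑ := by
        refine MeasureTheory.lintegral_mono_set fun t ht => ⟨ht.1.le, ht.2.trans hx.2⟩
      _ ≤ ∫⁻ t in Set.Icc a b, ENNReal.ofReal M * ENNReal.ofReal (speed γ t) := by
        refine MeasureTheory.lintegral_mono_ae ?_
        filter_upwards [hd] with t ht
        rw [← ENNReal.ofReal_mul hM, ← ofReal_norm, Real.norm_eq_abs]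
        exact ENNReal.ofReal_le_ofReal ht
      _ = ENNReal.ofReal M * length γ a b := by
        rw [MeasureTheory.lintegral_const_mul' _ _ ENNReal.ofReal_ne_top, length]
      _ ≤ ENNReal.ofReal (M * ε) := by
        rw [ENNReal.ofReal_mul hM]
        gcongr
  exact (ENNReal.ofReal_le_ofReal_iff (by positivity)).1 h1

/-- Along horizontal curves of length at most `ε ≤ 1`, each coordinate changes by at most a
multiple of `ε`, with a constant that depends only on the starting point. -/
theorem exists_coord_bound (p : JetSpace k) (j : Fin (k + 1)) : ∃ C : ℝ, 0 ≤ C ∧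
    ∀ (γ : ℝ → JetSpace k) (a b ε : ℝ), IsHorizontal γ a b → γ a = p → 0 ≤ ε → ε ≤ 1 →
      length γ a b ≤ ENNReal.ofReal ε → ∀ s ∈ Set.Icc a b, |(γ s).u j - p.u j| ≤ C * ε := by
  induction j using Fin.reverseInduction with
  | last =>
    refine ⟨1, zero_le_one, ?_⟩
    rintro γ a b ε hγ rfl h0 - hl s hs
    exact abs_sub_le_of_deriv_le zero_le_one h0 (hγ.ac_u _)
      (.of_forall fun s => by rw [one_mul]; exact abs_deriv_u_le γ s) hl hs
  | cast j ih =>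
    obtain ⟨C, hC, H⟩ := ih
    have hM : 0 ≤ |p.u j.succ| + C := by positivity
    refine ⟨|p.u j.succ| + C, hM, ?_⟩
    intro γ a b ε hγ hp h0 h1 hl s hs
    have hH := H γ a b ε hγ hp h0 h1 hl
    suffices hs' : |(γ s).u j.castSucc - (γ a).u j.castSucc| ≤ (|p.u j.succ| + C) * ε by
      rwa [hp] at hs'
    refine abs_sub_le_of_deriv_le (f := fun s => (γ s).u j.castSucc) hM h0 (hγ.ac_u _) ?_ hl hs
    filter_upwards [hγ.contact j, MeasureTheory.ae_restrict_mem measurableSet_Icc] with r hr hr'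
    rw [hr, abs_mul]
    refine mul_le_mul ?_ (abs_deriv_x_le γ r) (abs_nonneg _) hM
    have := hH r hr'
    have h2 : C * ε ≤ C := mul_le_of_le_one_right hC h1
    have h3 := abs_sub_abs_le_abs_sub ((γ r).u j.succ) (p.u j.succ)
    linarith

theorem eq_of_ccDist_eq_zero {p q : JetSpace k} (h : ccDist p q = 0) : p = q := by
  have key : ∀ ε : ℝ, 0 < ε → ∃ (γ : ℝ → JetSpace k) (a b : ℝ), a ≤ b ∧ IsHorizontal γ a b ∧
      γ a = p ∧ γ b = q ∧ length γ a b ≤ ENNReal.ofReal ε := fun ε hε => by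
    obtain ⟨γ, a, b, h1, h2, h3, h4, h5⟩ :=
      exists_of_ccDist_lt (h.trans_lt (ENNReal.ofReal_pos.2 hε))
    exact ⟨γ, a, b, h1, h2, h3, h4, h5.le⟩
  have small : ∀ C y : ℝ, 0 ≤ C → (∀ ε : ℝ, 0 < ε → ε ≤ 1 → |y| ≤ C * ε) → y = 0 := by
    intro C y hC H
    by_contra hy
    have hy' := abs_pos.2 hy
    have h1 := H (min 1 (|y| / (2 * (C + 1)))) (by positivity) (min_le_left _ _)
    have h2 : C * min 1 (|y| / (2 * (C + 1))) ≤ C * (|y| / (2 * (C + 1))) :=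
      mul_le_mul_of_nonneg_left (min_le_right _ _) hC
    have h3 : C * (|y| / (2 * (C + 1))) < |y| := by
      rw [mul_div_assoc', div_lt_iff₀ (by positivity)]
      nlinarith
    linarith
  ext j
  · refine (sub_eq_zero.1 (small 1 (q.x - p.x) zero_le_one fun ε hε _ => ?_)).symm
    obtain ⟨γ, a, b, hab, hγ, rfl, rfl, hl⟩ := key ε hε
    exact abs_sub_le_of_deriv_le zero_le_one hε.le hγ.ac_x
      (.of_forall fun s => by rw [one_mul]; exact abs_deriv_x_le γ s) hl ⟨hab, le_rfl⟩
  · obtain ⟨C, hC, H⟩ := exists_coord_bound p j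
    refine (sub_eq_zero.1 (small C (q.u j - p.u j) hC fun ε hε h1 => ?_)).symm
    obtain ⟨γ, a, b, hab, hγ, hp, rfl, hl⟩ := key ε hε
    exact H γ a b ε hγ hp hε.le h1 hl b ⟨hab, le_rfl⟩

/-- `J^k(ℝ)` with the Carnot–Carathéodory metric. -/
noncomputable instance : EMetricSpace (JetSpace k) where
  edist := ccDist
  edist_self := ccDist_self
  edist_comm p q := le_antisymm (ccDist_comm_le q p) (ccDist_comm_le p q)
  edist_triangle := ccDist_triangle
  eq_of_edist_eq_zero := eq_of_ccDist_eq_zero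

/-! ### The sets in the vertical hyperplanes -/

/-- The vertical hyperplane `{x = t}`. -/
def verticalPlane (k : ℕ) (t : ℝ) : Set (JetSpace k) := {p | p.x = t}

/-- The set `{t} × [0,1]^{j-1} × F × {0}^{k+1-j}`, in the order of coordinates
`(x, u_k, …, u_0)`: here `u_i` is the coordinate number `k + 1 - i` after `x`. -/
def verticalBox (k : ℕ) (t : ℝ) (j : ℕ) (F : Set ℝ) : Set (JetSpace k) :=
  {p | p.x = t ∧ ∀ i : Fin (k + 1),
    (k + 1 - (i : ℕ) < j → p.u i ∈ Set.Icc (0 : ℝ) 1) ∧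
    (k + 1 - (i : ℕ) = j → p.u i ∈ F) ∧
    (j < k + 1 - (i : ℕ) → p.u i = 0)}

end JetSpace

/-!
The dilations of `J^k(ℝ)` act on `u_i` with weight `k + 1 - i`, and inside a vertical plane
`{x = t}` the Carnot–Carathéodory distance is comparable to the maximum of
`|p.u i - q.u i| ^ (1 / (k + 1 - i))` (`JetSpace.hasWeights_mk`). For the lower bound, subtract from
the coordinates of a horizontal curve the jet of the polynomial whose jet at `t` is that of the
starting point; the new coordinates start at `0` and satisfy the same contact equations, so each
integration gains a power of the length (`JetSpace.abs_u_sub_le_of_length_le`). For the upper bound,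
leave the plane along the jet of a smooth function and return along the jet of a polynomial
(`JetSpace.exists_edist_le`).

A metric of this kind gives a product of sets `F i ⊆ ℝ` of dimension `s i` the dimension
`∑ i, w i * s i`, where `w i` is the weight of the coordinate, provided that each `F i` is regular:
it has efficient covers at every scale and carries a Frostman measure. Products of the covers bound
the dimension from above, and the product measure bounds it from below (`HasWeights.dimH_image`).
Points, the interval `[0, 1]` and self-similar Cantor sets provide regular sets of every dimension
`s ∈ [0, 1]` (`exists_isRegularSet`).

Finally, every `β ∈ [0, (k + 1) * (k + 2) / 2]` can be written as `j * (j - 1) / 2 + j * s` with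
`1 ≤ j ≤ k + 1` and `s ∈ [0, 1]`: the first summand is the total weight of the coordinates of weight
less than `j`, which range over `[0, 1]`, and the second is the contribution of the coordinate of
weight `j`, which ranges over a regular set of dimension `s`.
-/

/-! ### Regular subsets of the line -/

open MeasureTheory Metric

/-- A compact set `F ⊆ ℝ` is regular of dimension `s` if at every scale `δ ≤ 1` it can be covered
by `O(δ ^ (-s))` intervals of length `2 * δ`, and it carries a probability measure that gives mass
`O(δ ^ s)` to every such interval. -/
structure IsRegularSet (F : Set ℝ) (s : ℝ) : Prop where
  isCompact : IsCompact F
  nonneg : 0 ≤ s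
  cover : ∃ C : ℝ, 0 < C ∧ ∀ δ : ℝ, 0 < δ → δ ≤ 1 → ∃ T : Finset ℝ,
    (T.card : ℝ) ≤ C * δ ^ (-s) ∧ F ⊆ ⋃ y ∈ T, closedBall y δ
  frostman : ∃ μ : Measure ℝ, IsProbabilityMeasure μ ∧ μ Fᶜ = 0 ∧ ∃ C : ℝ, 0 < C ∧
    ∀ (x δ : ℝ), 0 < δ → μ (closedBall x δ) ≤ ENNReal.ofReal (C * δ ^ s)

theorem isRegularSet_singleton (a : ℝ) : IsRegularSet {a} 0 where
  isCompact := isCompact_singleton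
  nonneg := le_rfl
  cover := ⟨1, one_pos, fun δ hδ _ => ⟨{a}, by simp, by simpa using hδ.le⟩⟩
  frostman := ⟨Measure.dirac a, inferInstance, by simp, 1, one_pos, fun x δ _ => by
    simpa using prob_le_one (μ := Measure.dirac a)⟩

theorem isRegularSet_Icc : IsRegularSet (Set.Icc 0 1) 1 where
  isCompact := isCompact_Icc
  nonneg := zero_le_one
  cover := by
    refine ⟨3, by norm_num, fun δ hδ hδ1 => ?_⟩
    refine ⟨(Finset.range (⌈1 / δ⌉₊ + 1)).image fun m : ℕ => m * δ, ?_, fun x hx => ?_⟩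
    · refine (Nat.cast_le.2 Finset.card_image_le).trans ?_
      have h1 := Nat.ceil_lt_add_one (by positivity : 0 ≤ 1 / δ)
      have h2 : 1 ≤ 1 / δ := by rwa [le_div_iff₀ hδ, one_mul]
      rw [Finset.card_range, Real.rpow_neg_one, ← one_div]
      push_cast
      linarith
    · have h0 : 0 ≤ x / δ := div_nonneg hx.1 hδ.le
      simp only [Finset.mem_image, Finset.mem_range, Set.iUnion_exists, Set.biUnion_and',
        Set.iUnion_iUnion_eq_right, Set.mem_iUnion, exists_prop]
      refine ⟨⌊x / δ⌋₊, ?_, ?_⟩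
      · rw [Nat.lt_succ_iff]
        refine (Nat.floor_le_ceil _).trans (Nat.ceil_mono ?_)
        gcongr
        exact hx.2
      · have h1 := Nat.floor_le h0
        have h2 := Nat.lt_floor_add_one (x / δ)
        rw [le_div_iff₀ hδ] at h1
        rw [div_lt_iff₀ hδ] at h2
        rw [mem_closedBall, Real.dist_eq, abs_le]
        constructor <;> linarith
  frostman := by
    refine ⟨volume.restrict (Set.Icc 0 1), ⟨by simp⟩, by simp, 2, by norm_num, fun x δ hδ => ?_⟩
    refine (Measure.restrict_apply_le _ _).trans ?_
    rw [Real.volume_closedBall, Real.rpow_one]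

/-! ### Self-similar Cantor sets -/

/-- The point with address `a` in the Cantor set generated by the two contractions of ratio `r`
of `[0, 1]` that fix its end points. -/
noncomputable def cantorPoint (r : ℝ) (a : ℕ → Fin 2) : ℝ :=
  ∑' n, (1 - r) * (a n : ℕ) * r ^ n

section CantorPoint

variable {r : ℝ}

theorem cantorPoint_term_nonneg (h0 : 0 ≤ r) (h1 : r < 1) (a : ℕ → Fin 2) (n : ℕ) :
    0 ≤ (1 - r) * (a n : ℕ) * r ^ n :=
  mul_nonneg (mul_nonneg (by linarith) (Nat.cast_nonneg _)) (pow_nonneg h0 _)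

theorem cantorPoint_term_le (h0 : 0 ≤ r) (h1 : r < 1) (a : ℕ → Fin 2) (n : ℕ) :
    (1 - r) * (a n : ℕ) * r ^ n ≤ (1 - r) * r ^ n := by
  refine mul_le_mul_of_nonneg_right (mul_le_of_le_one_right (by linarith) ?_) (pow_nonneg h0 _)
  exact_mod_cast Nat.lt_succ_iff.1 (a n).2

theorem summable_cantorPoint (h0 : 0 ≤ r) (h1 : r < 1) (a : ℕ → Fin 2) :
    Summable fun n => (1 - r) * (a n : ℕ) * r ^ n :=
  .of_nonneg_of_le (cantorPoint_term_nonneg h0 h1 a) (cantorPoint_term_le h0 h1 a)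
    ((summable_geometric_of_lt_one h0 h1).mul_left _)

theorem cantorPoint_nonneg (h0 : 0 ≤ r) (h1 : r < 1) (a : ℕ → Fin 2) : 0 ≤ cantorPoint r a :=
  tsum_nonneg (cantorPoint_term_nonneg h0 h1 a)

theorem cantorPoint_le_one (h0 : 0 ≤ r) (h1 : r < 1) (a : ℕ → Fin 2) : cantorPoint r a ≤ 1 := by
  refine ((summable_cantorPoint h0 h1 a).tsum_le_tsum (cantorPoint_term_le h0 h1 a)
    ((summable_geometric_of_lt_one h0 h1).mul_left _)).trans_eq ?_
  rw [tsum_mul_left, tsum_geometric_of_lt_one h0 h1, mul_inv_cancel₀ (by linarith)]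

theorem continuous_cantorPoint (h0 : 0 ≤ r) (h1 : r < 1) : Continuous (cantorPoint r) := by
  refine continuous_tsum (fun n => ?_) ((summable_geometric_of_lt_one h0 h1).mul_left (1 - r))
    fun n a => ?_
  · have : Continuous fun m : Fin 2 => (m : ℕ) := continuous_of_discreteTopology
    fun_prop
  · rw [Real.norm_of_nonneg (cantorPoint_term_nonneg h0 h1 a n)]
    exact cantorPoint_term_le h0 h1 a n

theorem cantorPoint_eq (h0 : 0 ≤ r) (h1 : r < 1) (a : ℕ → Fin 2) (n : ℕ) :
    cantorPoint r a = ∑ i ∈ Finset.range n, (1 - r) * (a i : ℕ) * r ^ i +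
      r ^ n * cantorPoint r fun i => a (i + n) := by
  rw [cantorPoint, cantorPoint, ← (summable_cantorPoint h0 h1 a).sum_add_tsum_nat_add n,
    ← tsum_mul_left]
  congr 2
  ext i
  ring

theorem cantorPoint_sub (h0 : 0 ≤ r) (h1 : r < 1) {a b : ℕ → Fin 2} {n : ℕ}
    (h : ∀ i < n, a i = b i) : cantorPoint r a - cantorPoint r b =
      r ^ n * (cantorPoint r (fun i => a (i + n)) - cantorPoint r fun i => b (i + n)) := by
  have : ∑ i ∈ Finset.range n, (1 - r) * (a i : ℕ) * r ^ i =
      ∑ i ∈ Finset.range n, (1 - r) * (b i : ℕ) * r ^ i :=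
    Finset.sum_congr rfl fun i hi => by rw [h i (Finset.mem_range.1 hi)]
  rw [cantorPoint_eq h0 h1 a n, cantorPoint_eq h0 h1 b n, this]
  ring

theorem abs_cantorPoint_sub_le (h0 : 0 ≤ r) (h1 : r < 1) {a b : ℕ → Fin 2} {n : ℕ}
    (h : ∀ i < n, a i = b i) : |cantorPoint r a - cantorPoint r b| ≤ r ^ n := by
  rw [cantorPoint_sub h0 h1 h, abs_mul, abs_of_nonneg (pow_nonneg h0 n)]
  refine mul_le_of_le_one_right (pow_nonneg h0 n) ?_
  rw [abs_le]
  constructor <;>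
    linarith [cantorPoint_nonneg h0 h1 fun i => a (i + n),
      cantorPoint_nonneg h0 h1 fun i => b (i + n),
      cantorPoint_le_one h0 h1 fun i => a (i + n), cantorPoint_le_one h0 h1 fun i => b (i + n)]

/-- The gap between the two halves of a cylinder of level `n` has length `(1 - 2 * r) * r ^ n`. -/
theorem le_abs_cantorPoint_sub (h0 : 0 ≤ r) (h1 : r < 1) {a b : ℕ → Fin 2} {n : ℕ}
    (h : ∀ i < n, a i = b i) (hn : a n ≠ b n) :
    (1 - 2 * r) * r ^ n ≤ |cantorPoint r a - cantorPoint r b| := by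
  have key : ∀ a b : ℕ → Fin 2, (∀ i < n, a i = b i) → a n = 0 → b n = 1 →
      (1 - 2 * r) * r ^ n ≤ cantorPoint r b - cantorPoint r a := by
    intro a b h ha hb
    rw [cantorPoint_sub h0 h1 fun i hi => (h i hi).symm, mul_comm]
    refine mul_le_mul_of_nonneg_left ?_ (pow_nonneg h0 n)
    rw [cantorPoint_eq h0 h1 (fun i => a (i + n)) 1, cantorPoint_eq h0 h1 (fun i => b (i + n)) 1]
    have e1 := cantorPoint_nonneg h0 h1 fun i => b (i + 1 + n)
    have e2 := cantorPoint_le_one h0 h1 fun i => a (i + 1 + n)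
    simp only [Finset.range_one, Finset.sum_singleton, zero_add, ha, hb, Fin.val_zero, Fin.val_one,
      pow_zero, pow_one, Nat.cast_zero, Nat.cast_one]
    nlinarith
  have h2 : (a n = 0 ∧ b n = 1) ∨ (b n = 0 ∧ a n = 1) := by omega
  rcases h2 with ⟨ha, hb⟩ | ⟨hb, ha⟩
  · rw [abs_sub_comm]
    exact (key a b h ha hb).trans (le_abs_self _)
  · exact (key b a (fun i hi => (h i hi).symm) hb ha).trans (le_abs_self _)

end CantorPoint

theorem measurable_digits : Measurable fun x : ℝ => Real.digits x 2 := by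
  refine measurable_pi_iff.2 fun n => ?_
  unfold Real.digits
  exact (measurable_of_countable fun m : ℕ => Fin.ofNat 2 m).comp
    (Nat.measurable_floor.comp (by fun_prop))

/-- The map from addresses to the numbers with these binary digits is `s`-Hölder on the Cantor set:
if two addresses first differ at place `n`, the numbers are `2 ^ (-n) = (r ^ n) ^ s`-close, and the
points of the Cantor set are separated by a gap of length `(1 - 2 * r) * r ^ n`. -/
theorem abs_sub_le_cantorPoint_digits {r s : ℝ} (h0 : 0 < r) (h1 : r < 1 / 2) (hs : 0 ≤ s)
    (hrs : r ^ s = 1 / 2) {x y : ℝ} (hx : x ∈ Set.Ico (0 : ℝ) 1) (hy : y ∈ Set.Ico (0 : ℝ) 1) :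
    |x - y| ≤ ((1 - 2 * r)⁻¹ *
      |cantorPoint r (Real.digits x 2) - cantorPoint r (Real.digits y 2)|) ^ s := by
  by_cases hxy : x = y
  · subst hxy
    rw [sub_self, abs_zero, sub_self, abs_zero, mul_zero]
    exact Real.zero_rpow_nonneg s
  have hne : Real.digits x 2 ≠ Real.digits y 2 := fun he => hxy <| by
    rw [← Real.ofDigits_digits one_lt_two hx, ← Real.ofDigits_digits one_lt_two hy, he]
  have hex : ∃ n, Real.digits x 2 n ≠ Real.digits y 2 n := Function.ne_iff.1 hne
  classical
  set n := Nat.find hex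
  have hn : Real.digits x 2 n ≠ Real.digits y 2 n := Nat.find_spec hex
  have hlt : ∀ i < n, Real.digits x 2 i = Real.digits y 2 i := fun i hi =>
    not_not.1 (Nat.find_min hex hi)
  have e1 := Real.abs_ofDigits_sub_ofDigits_le hlt
  rw [Real.ofDigits_digits one_lt_two hx, Real.ofDigits_digits one_lt_two hy] at e1
  have e2 := le_abs_cantorPoint_sub h0.le (by linarith) hlt hn
  have hg : 0 < 1 - 2 * r := by linarith
  rw [mul_comm, ← le_div_iff₀ hg, div_eq_inv_mul] at e2
  calc |x - y| ≤ ((2 : ℝ) ^ n)⁻¹ := by simpa using e1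
    _ = (r ^ n) ^ s := by
      rw [← Real.rpow_natCast r, ← Real.rpow_mul h0.le, mul_comm, Real.rpow_mul h0.le, hrs,
        Real.rpow_natCast, one_div, inv_pow]
    _ ≤ _ := Real.rpow_le_rpow (by positivity) e2 hs

theorem isRegularSet_range_cantorPoint {r s : ℝ} (h0 : 0 < r) (h1 : r < 1 / 2) (hs : 0 ≤ s)
    (hrs : r ^ s = 1 / 2) : IsRegularSet (Set.range (cantorPoint r)) s where
  isCompact := isCompact_range (continuous_cantorPoint h0.le (by linarith))
  nonneg := hs
  cover := by
    refine ⟨2, two_pos, fun δ hδ hδ1 => ?_⟩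
    obtain ⟨n, hn, hn'⟩ := exists_nat_pow_near_of_lt_one hδ hδ1 h0 (by linarith : r < 1)
    -- the `2 ^ (n + 1)` cylinders of level `n + 1`
    let c : (Fin (n + 1) → Fin 2) → ℝ := fun a =>
      cantorPoint r fun i => if h : i < n + 1 then a ⟨i, h⟩ else 0
    refine ⟨Finset.univ.image c, ?_, ?_⟩
    · have hc : ((Finset.univ.image c).card : ℝ) ≤ 2 ^ (n + 1) := by
        refine (Nat.cast_le.2 Finset.card_image_le).trans_eq ?_
        simp
      have h2 : (2 : ℝ) ^ n = (r ^ n) ^ (-s) := by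
        rw [Real.rpow_neg (by positivity), ← Real.rpow_natCast r, ← Real.rpow_mul h0.le, mul_comm,
          Real.rpow_mul h0.le, hrs, Real.rpow_natCast, one_div, inv_pow, inv_inv]
      have h3 : (r ^ n) ^ (-s) ≤ δ ^ (-s) := Real.rpow_le_rpow_of_nonpos hδ hn' (by linarith)
      rw [pow_succ, h2] at hc
      linarith
    · rintro _ ⟨a, rfl⟩
      simp only [Finset.mem_image, Finset.mem_univ, true_and, Set.iUnion_exists,
        Set.iUnion_iUnion_eq', Set.mem_iUnion]
      refine ⟨fun i => a i, ?_⟩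
      rw [mem_closedBall, Real.dist_eq]
      refine (abs_cantorPoint_sub_le h0.le (by linarith) (n := n + 1) fun i hi => ?_).trans hn.le
      simp [hi]
  frostman := by
    -- push Lebesgue measure on `[0, 1)` to the Cantor set by reading binary digits as addresses
    let h : ℝ → ℝ := fun x => cantorPoint r (Real.digits x 2)
    have hm : Measurable h :=
      (continuous_cantorPoint h0.le (by linarith)).measurable.comp measurable_digits
    have hg : 0 < 1 - 2 * r := by linarith
    have : IsProbabilityMeasure (volume.restrict (Set.Ico (0 : ℝ) 1)) := ⟨by simp⟩
    refine ⟨(volume.restrict (Set.Ico (0 : ℝ) 1)).map h,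
      Measure.isProbabilityMeasure_map hm.aemeasurable, ?_, ((1 - 2 * r)⁻¹ * 2) ^ s,
      by positivity, fun x δ hδ => ?_⟩
    · rw [Measure.map_apply hm (isCompact_range
        (continuous_cantorPoint h0.le (by linarith))).measurableSet.compl]
      convert measure_empty (μ := volume.restrict (Set.Ico (0 : ℝ) 1))
      ext y
      simp [h]
    · rw [Measure.map_apply hm measurableSet_closedBall,
        Measure.restrict_apply (hm measurableSet_closedBall)]
      refine (Real.volume_le_diam _).trans (ediam_le ?_)
      rintro y ⟨hy, hy'⟩ z ⟨hz, hz'⟩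
      rw [edist_dist, Real.dist_eq, ← Real.mul_rpow (by positivity) hδ.le, mul_assoc]
      refine ENNReal.ofReal_le_ofReal
        ((abs_sub_le_cantorPoint_digits h0 h1 hs hrs hy' hz').trans ?_)
      refine Real.rpow_le_rpow (by positivity) (mul_le_mul_of_nonneg_left ?_ (by positivity)) hs
      have e1 : |h y - x| ≤ δ := hy
      have e2 : |h z - x| ≤ δ := hz
      have e3 := abs_sub_le (h y) x (h z)
      rw [abs_sub_comm x] at e3
      change |h y - h z| ≤ 2 * δ
      linarith

theorem exists_isRegularSet {s : ℝ} (hs0 : 0 ≤ s) (hs1 : s ≤ 1) : ∃ F, IsRegularSet F s := by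
  rcases hs0.eq_or_lt with rfl | hs0
  · exact ⟨_, isRegularSet_singleton 0⟩
  rcases hs1.eq_or_lt with rfl | hs1
  · exact ⟨_, isRegularSet_Icc⟩
  -- the ratio `r` for which two copies scaled by `r` have total `s`-dimensional mass one
  refine ⟨_, isRegularSet_range_cantorPoint (r := (1 / 2 : ℝ) ^ s⁻¹) (by positivity) ?_ hs0.le ?_⟩
  · conv_rhs => rw [← Real.rpow_one (1 / 2)]
    exact Real.rpow_lt_rpow_of_exponent_gt (by norm_num) (by norm_num) ((one_lt_inv₀ hs0).2 hs1)
  · rw [← Real.rpow_mul (by norm_num), inv_mul_cancel₀ hs0.ne', Real.rpow_one]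

/-! ### Hausdorff dimension of products with weighted coordinates -/

section Weighted

variable {ι X : Type*} [Fintype ι] [EMetricSpace X]

/-- A parametrization `σ` of part of a metric space by `ι → ℝ` has *weights* `w` if balls of radius
`ε` are comparable to boxes with sides `ε ^ w i`. -/
structure HasWeights (σ : (ι → ℝ) → X) (w : ι → ℕ) : Prop where
  one_le : ∀ i, 1 ≤ w i
  abs_sub_le_pow : ∀ (u v : ι → ℝ) (ε : ℝ), 0 < ε → edist (σ u) (σ v) < ENNReal.ofReal ε →
    ∀ i, |u i - v i| ≤ ε ^ w i
  edist_le : ∃ C : ℝ, 0 < C ∧ ∀ (u v : ι → ℝ) (ε : ℝ), 0 < ε → (∀ i, |u i - v i| ≤ ε ^ w i) →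
    edist (σ u) (σ v) ≤ ENNReal.ofReal (C * ε)

theorem HasWeights.continuous {σ : (ι → ℝ) → X} {w : ι → ℕ} (h : HasWeights σ w) :
    Continuous σ := by
  obtain ⟨C, hC, H⟩ := h.edist_le
  rw [continuous_iff_continuousAt]
  intro v
  rw [ContinuousAt, EMetric.tendsto_nhds]
  intro r hr
  obtain ⟨ρ, hρ, hρr⟩ : ∃ ρ : ℝ, 0 < ρ ∧ ENNReal.ofReal ρ < r := by
    obtain ⟨q, hq, hqr⟩ := ENNReal.lt_iff_exists_nnreal_btwn.1 hr
    exact ⟨q, by simpa using hq, by simpa using hqr⟩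
  have hev : ∀ᶠ u in nhds v, ∀ i, |u i - v i| ≤ (ρ / C) ^ w i := by
    rw [Filter.eventually_all]
    intro i
    have : Filter.Tendsto (fun u : ι → ℝ => |u i - v i|) (nhds v) (nhds |v i - v i|) :=
      Continuous.tendsto (by fun_prop) v
    rw [sub_self, abs_zero] at this
    exact (this.eventually (gt_mem_nhds (by positivity))).mono fun _ => le_of_lt
  filter_upwards [hev] with u hu
  have := H u v (ρ / C) (by positivity) hu
  rw [mul_div_cancel₀ _ hC.ne'] at this
  exact this.trans_lt hρr

variable {σ : (ι → ℝ) → X} {w : ι → ℕ} {F : ι → Set ℝ} {s : ι → ℝ}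

theorem HasWeights.dimH_image_le (h : HasWeights σ w) (hF : ∀ i, IsRegularSet (F i) (s i)) :
    dimH (σ '' Set.univ.pi F) ≤ ENNReal.ofReal (∑ i, w i * s i) := by
  borelize X
  classical
  set D := ∑ i, w i * s i with hD
  have hD0 : 0 ≤ D := Finset.sum_nonneg fun i _ => mul_nonneg (by positivity) (hF i).nonneg
  obtain ⟨C, hC, H⟩ := h.edist_le
  choose K hK0 hK using fun i => (hF i).cover
  obtain ⟨ε, hε0, hε1, hε⟩ : ∃ ε : ℕ → ℝ, (∀ n, 0 < ε n) ∧ (∀ n, ε n ≤ 1) ∧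
      Filter.Tendsto ε Filter.atTop (nhds 0) :=
    ⟨fun n => 1 / ((n : ℝ) + 1), fun n => by positivity, fun n => by
      rw [div_le_one (by positivity)]; linarith [(n.cast_nonneg : (0 : ℝ) ≤ n)],
      tendsto_one_div_add_atTop_nhds_zero_nat⟩
  choose T hTc hT using fun n i => hK i (ε n ^ w i) (pow_pos (hε0 n) _)
    (pow_le_one₀ (hε0 n).le (hε1 n))
  let t : ∀ n, Fintype.piFinset (T n) → Set X := fun n τ =>
    σ '' {u | ∀ i, |u i - τ.1 i| ≤ ε n ^ w i}
  have hdiam : ∀ n τ, ediam (t n τ) ≤ ENNReal.ofReal (C * (2 * ε n)) := by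
    intro n τ
    refine ediam_le ?_
    rintro _ ⟨u, hu, rfl⟩ _ ⟨v, hv, rfl⟩
    refine H u v _ (by linarith [hε0 n]) fun i => ?_
    have h1 := abs_sub_le (u i) (τ.1 i) (v i)
    have h2 := hu i
    have h3 := hv i
    rw [abs_sub_comm] at h3
    have h4 : (2 : ℝ) ≤ 2 ^ w i := le_self_pow₀ one_le_two (Nat.one_le_iff_ne_zero.1 (h.one_le i))
    rw [mul_pow]
    nlinarith [pow_pos (hε0 n) (w i)]
  have hr : Filter.Tendsto (fun n => ENNReal.ofReal (C * (2 * ε n))) Filter.atTop (nhds 0) := by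
    rw [← ENNReal.ofReal_zero]
    refine (ENNReal.continuous_ofReal.tendsto _).comp ?_
    simpa using (hε.const_mul 2).const_mul C
  have hcov : ∀ n, σ '' Set.univ.pi F ⊆ ⋃ τ, t n τ := by
    rintro n _ ⟨u, hu, rfl⟩
    have : ∀ i, ∃ y ∈ T n i, |u i - y| ≤ ε n ^ w i := fun i => by
      simpa [Real.dist_eq] using hT n i (hu i trivial)
    choose y hy hy' using this
    exact Set.mem_iUnion.2 ⟨⟨y, Fintype.mem_piFinset.2 hy⟩, u, hy', rfl⟩
  have key := Measure.hausdorffMeasure_le_liminf_sum D (σ '' Set.univ.pi F) _ hr t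
    (.of_forall hdiam) (.of_forall hcov)
  -- the number of boxes of scale `ε` is at most `(∏ K i) * ε ^ (-D)`
  have hcard : ∀ n, ((Fintype.piFinset (T n)).card : ℝ) * (C * (2 * ε n)) ^ D ≤
      (∏ i, K i) * (C * 2) ^ D := by
    intro n
    have h1 : ∀ i, (ε n ^ w i) ^ (-s i) = ε n ^ (-(w i * s i)) := fun i => by
      rw [← Real.rpow_natCast, ← Real.rpow_mul (hε0 n).le, mul_neg]
    have h2 : ((Fintype.piFinset (T n)).card : ℝ) ≤ (∏ i, K i) * ε n ^ (-D) := by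
      rw [Fintype.card_piFinset, Nat.cast_prod]
      refine (Finset.prod_le_prod (fun i _ => by positivity) fun i _ => hTc n i).trans_eq ?_
      simp only [h1]
      rw [Finset.prod_mul_distrib, ← Real.rpow_sum_of_pos (hε0 n), Finset.sum_neg_distrib]
    have h3 : 0 ≤ (C * (2 * ε n)) ^ D := by
      have := hε0 n
      positivity
    refine (mul_le_mul_of_nonneg_right h2 h3).trans_eq ?_
    rw [← mul_assoc C, Real.mul_rpow (by positivity) (hε0 n).le, Real.rpow_neg (hε0 n).le]
    have := Real.rpow_pos_of_pos (hε0 n) D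
    field_simp
  have hsum : ∀ n, ∑ τ, ediam (t n τ) ^ D ≤ ENNReal.ofReal ((∏ i, K i) * (C * 2) ^ D) := by
    intro n
    have h3 : 0 ≤ C * (2 * ε n) := by
      have := hε0 n
      positivity
    refine (Finset.sum_le_card_nsmul Finset.univ _ (ENNReal.ofReal ((C * (2 * ε n)) ^ D))
      fun τ _ => ?_).trans ?_
    · rw [← ENNReal.ofReal_rpow_of_nonneg h3 hD0]
      exact ENNReal.rpow_le_rpow (hdiam n τ) hD0
    · rw [Finset.card_univ, Fintype.card_coe, nsmul_eq_mul, ← ENNReal.ofReal_natCast,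
        ← ENNReal.ofReal_mul (Nat.cast_nonneg _)]
      exact ENNReal.ofReal_le_ofReal (hcard n)
  have hfin : μH[D] (σ '' Set.univ.pi F) ≠ ∞ :=
    ((key.trans (Filter.liminf_le_liminf (.of_forall hsum))).trans_lt (by
      simp [Filter.liminf_const])).ne
  exact dimH_le_of_hausdorffMeasure_ne_top (d := D.toNNReal) (by rwa [Real.coe_toNNReal _ hD0])

/-- The mass distribution principle for the product of the Frostman measures of the factors. -/
theorem HasWeights.le_dimH_image (h : HasWeights σ w) (hF : ∀ i, IsRegularSet (F i) (s i)) :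
    ENNReal.ofReal (∑ i, w i * s i) ≤ dimH (σ '' Set.univ.pi F) := by
  borelize X
  set D := ∑ i, w i * s i with hD
  have hD0 : 0 ≤ D := Finset.sum_nonneg fun i _ => mul_nonneg (by positivity) (hF i).nonneg
  choose μ hμ hμF K hK0 hK using fun i => (hF i).frostman
  set M := ENNReal.ofReal (∏ i, K i) with hM
  have hM0 : M ≠ 0 := by
    rw [hM, Ne, ENNReal.ofReal_eq_zero, not_le]
    exact Finset.prod_pos fun i _ => hK0 i
  -- an outer measure, because the mass bound is needed for arbitrary, possibly nonmeasurable, sets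
  let ν : OuterMeasure X := M⁻¹ • OuterMeasure.map σ (Measure.pi μ).toOuterMeasure
  have hν : ∀ A : Set X, ν A = M⁻¹ * Measure.pi μ (σ ⁻¹' A) := fun A => by
    simp [ν, OuterMeasure.map_apply]
  have hball : ∀ A : Set X, ∀ ε : ℝ, 0 < ε → ediam A < ENNReal.ofReal ε →
      ν A ≤ ENNReal.ofReal ε ^ D := by
    intro A ε hε hA
    rw [hν, ENNReal.inv_mul_le_iff hM0 ENNReal.ofReal_ne_top]
    rcases (σ ⁻¹' A).eq_empty_or_nonempty with h0 | ⟨v, hv⟩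
    · simp [h0]
    have hsub : σ ⁻¹' A ⊆ Set.univ.pi fun i => closedBall (v i) (ε ^ w i) := fun u hu i _ => by
      rw [mem_closedBall, Real.dist_eq]
      exact h.abs_sub_le_pow u v ε hε ((edist_le_ediam_of_mem (s := A) hu hv).trans_lt hA) i
    calc Measure.pi μ (σ ⁻¹' A) ≤ Measure.pi μ (Set.univ.pi fun i => closedBall (v i) (ε ^ w i)) :=
          measure_mono hsub
      _ = ∏ i, μ i (closedBall (v i) (ε ^ w i)) := Measure.pi_pi _ _
      _ ≤ ∏ i, ENNReal.ofReal (K i * (ε ^ w i) ^ s i) :=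
          Finset.prod_le_prod' fun i _ => hK i _ _ (by positivity)
      _ = ENNReal.ofReal (∏ i, K i * (ε ^ w i) ^ s i) := by
          rw [ENNReal.ofReal_prod_of_nonneg fun i _ => by have := hK0 i; positivity]
      _ = M * ENNReal.ofReal ε ^ D := by
          rw [ENNReal.ofReal_rpow_of_pos hε, hM, ← ENNReal.ofReal_mul
            (Finset.prod_nonneg fun i _ => (hK0 i).le), Finset.prod_mul_distrib, hD,
            Real.rpow_sum_of_pos hε]
          simp only [← Real.rpow_natCast, ← Real.rpow_mul hε.le]
  have hdiam : ∀ A : Set X, ediam A ≤ 1 → ν A ≤ ediam A ^ D := by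
    intro A hA
    have hne : ediam A ≠ ∞ := (hA.trans_lt ENNReal.one_lt_top).ne
    have hlim : Filter.Tendsto (fun ε : ℝ => ENNReal.ofReal ε ^ D)
        (nhdsWithin (ediam A).toReal (Set.Ioi (ediam A).toReal)) (nhds (ediam A ^ D)) := by
      have : Continuous fun ε : ℝ => ENNReal.ofReal ε ^ D :=
        ENNReal.continuous_rpow_const.comp ENNReal.continuous_ofReal
      have := this.tendsto (ediam A).toReal
      rw [ENNReal.ofReal_toReal hne] at this
      exact this.mono_left nhdsWithin_le_nhds
    refine ge_of_tendsto hlim ?_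
    filter_upwards [self_mem_nhdsWithin] with ε hε
    have hε' : (ediam A).toReal < ε := hε
    exact hball A ε (ENNReal.toReal_nonneg.trans_lt hε')
      ((ENNReal.lt_ofReal_iff_toReal_lt hne).2 hε')
  have hle := OuterMeasure.le_mkMetric (fun r => r ^ D) ν 1 one_pos hdiam (σ '' Set.univ.pi F)
  rw [OuterMeasure.coe_mkMetric] at hle
  have hpos : ν (σ '' Set.univ.pi F) ≠ 0 := by
    rw [hν]
    refine mul_ne_zero (ENNReal.inv_ne_zero.2 ENNReal.ofReal_ne_top) (ne_of_gt ?_)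
    refine lt_of_lt_of_le ?_ (measure_mono (Set.subset_preimage_image σ _))
    rw [Measure.pi_pi]
    have : ∀ i, μ i (F i) = 1 := fun i => by
      exact (prob_compl_eq_zero_iff (hF i).isCompact.measurableSet).1 (hμF i)
    simp [this]
  refine le_dimH_of_hausdorffMeasure_ne_zero (d := D.toNNReal) ?_
  rw [Real.coe_toNNReal _ hD0]
  exact ((pos_iff_ne_zero.2 hpos).trans_le hle).ne'

theorem HasWeights.dimH_image (h : HasWeights σ w) (hF : ∀ i, IsRegularSet (F i) (s i)) :
    dimH (σ '' Set.univ.pi F) = ENNReal.ofReal (∑ i, w i * s i) :=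
  (h.dimH_image_le hF).antisymm (h.le_dimH_image hF)

end Weighted

theorem IsRegularSet.dimH_eq {F : Set ℝ} {s : ℝ} (hF : IsRegularSet F s) :
    dimH F = ENNReal.ofReal s := by
  have hw : HasWeights (fun u : Unit → ℝ => u ()) (fun _ => 1) := by
    refine ⟨fun _ => le_rfl, fun u v ε hε hd i => ?_, 1, one_pos, fun u v ε _ hd => ?_⟩
    · rw [edist_dist, Real.dist_eq, ENNReal.ofReal_lt_ofReal_iff hε] at hd
      simpa using hd.le
    · rw [edist_dist, Real.dist_eq]
      exact ENNReal.ofReal_le_ofReal (by simpa using hd ())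
  have := hw.dimH_image fun _ => hF
  convert this using 1
  · congr 1
    ext x
    exact ⟨fun hx => ⟨fun _ => x, fun _ _ => hx, rfl⟩, by rintro ⟨u, hu, rfl⟩; exact hu () trivial⟩
  · simp

/-! ### Taylor polynomials and the lower bound for the distance in a vertical plane -/

namespace JetSpace

variable {k : ℕ}

/-- The polynomial of degree at most `k` whose derivatives of order `0, …, k` at `t` are `v`. -/
noncomputable def taylorPoly (t : ℝ) (v : Fin (k + 1) → ℝ) : Polynomial ℝ :=
  ∑ m : Fin (k + 1), Polynomial.C (v m / (m : ℕ).factorial) *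
    (Polynomial.X - Polynomial.C t) ^ (m : ℕ)

theorem iterate_derivative_taylorPoly (t : ℝ) (v : Fin (k + 1) → ℝ) (n : ℕ) :
    Polynomial.derivative^[n] (taylorPoly t v) = ∑ m : Fin (k + 1),
      Polynomial.C (v m / (m : ℕ).factorial) * ((m : ℕ).descFactorial n •
        (Polynomial.X - Polynomial.C t) ^ ((m : ℕ) - n)) := by
  rw [taylorPoly, Polynomial.iterate_derivative_sum]
  simp only [Polynomial.iterate_derivative_C_mul, Polynomial.iterate_derivative_X_sub_pow]

theorem eval_iterate_derivative_taylorPoly (t : ℝ) (v : Fin (k + 1) → ℝ) (i : Fin (k + 1)) :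
    (Polynomial.derivative^[i] (taylorPoly t v)).eval t = v i := by
  rw [iterate_derivative_taylorPoly, Polynomial.eval_finsetSum, Finset.sum_eq_single i]
  · simp [Nat.descFactorial_self, Nat.factorial_ne_zero]
  · intro m _ hm
    rcases lt_or_gt_of_ne (Fin.val_ne_of_ne hm) with h | h
    · simp [Nat.descFactorial_eq_zero_iff_lt.2 h]
    · simp [zero_pow (Nat.sub_ne_zero_of_lt h)]
  · simp

theorem iterate_derivative_taylorPoly_eq_zero (t : ℝ) (v : Fin (k + 1) → ℝ) :
    Polynomial.derivative^[k + 1] (taylorPoly t v) = 0 := by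
  rw [iterate_derivative_taylorPoly]
  refine Finset.sum_eq_zero fun m _ => ?_
  rw [Nat.descFactorial_eq_zero_iff_lt.2 m.2, zero_smul, mul_zero]

theorem ac_polynomial {f : ℝ → ℝ} {a b : ℝ} (hf : AbsolutelyContinuousOnInterval f a b)
    (P : Polynomial ℝ) : AbsolutelyContinuousOnInterval (fun s => P.eval (f s)) a b := by
  induction P using Polynomial.induction_on' with
  | add P Q hP hQ => simpa using hP.fun_add hQ
  | monomial n c =>
    simp only [Polynomial.eval_monomial]
    refine AbsolutelyContinuousOnInterval.const_mul c ?_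
    induction n with
    | zero => simpa using contDiffOn_const.absolutelyContinuousOnInterval
    | succ n ih => simpa only [pow_succ] using ih.fun_mul hf

theorem ae_differentiableAt_of_ac {f : ℝ → ℝ} {a b : ℝ} (hab : a ≤ b)
    (hf : AbsolutelyContinuousOnInterval f a b) :
    ∀ᵐ s ∂(MeasureTheory.volume.restrict (Set.Icc a b)), DifferentiableAt ℝ f s := by
  rw [MeasureTheory.ae_restrict_iff' measurableSet_Icc]
  filter_upwards [hf.ae_differentiableAt] with s hs hs'
  exact hs (by rwa [Set.uIcc_of_le hab])

/-- Subtracting from `u` the jet of the polynomial with the same jet as the starting point is a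
symmetry of the contact forms; after that each coordinate starts at `0`, so that integrating
`u_j' = u_{j+1} x'` gains one power of the length `ε` at each step. -/
theorem abs_u_sub_le_of_length_le {γ : ℝ → JetSpace k} {a b ε : ℝ} (hab : a ≤ b)
    (hγ : IsHorizontal γ a b) (hx : (γ b).x = (γ a).x) (hε : 0 ≤ ε)
    (hl : length γ a b ≤ ENNReal.ofReal ε) (i : Fin (k + 1)) :
    |(γ b).u i - (γ a).u i| ≤ ε ^ (k + 1 - (i : ℕ)) := by
  set P := taylorPoly (γ a).x (γ a).u with hP
  let y : ℕ → ℝ → ℝ := fun n s => (Polynomial.derivative^[n] P).eval (γ s).x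
  have hac : ∀ i : Fin (k + 1),
      AbsolutelyContinuousOnInterval (fun s => (γ s).u i - y i s) a b := fun i =>
    (hγ.ac_u i).fun_sub (ac_polynomial hγ.ac_x _)
  have hy : ∀ i : Fin (k + 1), y i a = (γ a).u i := fun i =>
    eval_iterate_derivative_taylorPoly _ _ i
  have hd : ∀ i : Fin (k + 1), ∀ᵐ s ∂(MeasureTheory.volume.restrict (Set.Icc a b)),
      deriv (fun s => (γ s).u i - y i s) s =
        deriv (fun s => (γ s).u i) s - y (i + 1) s * deriv (fun s => (γ s).x) s := by
    intro i
    filter_upwards [ae_differentiableAt_of_ac hab hγ.ac_x,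
      ae_differentiableAt_of_ac hab (hγ.ac_u i)] with s h1 h2
    have h3 := ((Polynomial.derivative^[(i : ℕ)] P).hasDerivAt (γ s).x).comp s h1.hasDerivAt
    refine (h2.hasDerivAt.sub h3).deriv.trans ?_
    simp only [y, Function.iterate_succ_apply']
  have key : ∀ s ∈ Set.Icc a b, |(γ s).u i - y i s| ≤ ε ^ (k + 1 - (i : ℕ)) := by
    induction i using Fin.reverseInduction with
    | last =>
      intro s hs
      have h := abs_sub_le_of_deriv_le zero_le_one hε (hac (Fin.last k)) ?_ hl hs
      · rw [hy, sub_self, sub_zero, one_mul] at h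
        simpa using h
      · filter_upwards [hd (Fin.last k)] with r hr
        have h0 : y (k + 1) r = 0 := by
          simp only [y, hP, iterate_derivative_taylorPoly_eq_zero, Polynomial.eval_zero]
        rw [hr, Fin.val_last, h0, zero_mul, sub_zero, one_mul]
        exact abs_deriv_u_le γ r
    | cast j ih =>
      intro s hs
      have h := abs_sub_le_of_deriv_le (M := ε ^ (k - (j : ℕ))) (pow_nonneg hε _) hε
        (hac j.castSucc) ?_ hl hs
      · have e : k + 1 - (j.castSucc : ℕ) = k - (j : ℕ) + 1 := by
          have := j.2
          rw [Fin.val_castSucc]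
          omega
        rw [hy, sub_self, sub_zero] at h
        rwa [e, pow_succ]
      · filter_upwards [hd j.castSucc, hγ.contact j,
          MeasureTheory.ae_restrict_mem measurableSet_Icc] with r hr hc hr'
        rw [hr, hc, Fin.val_castSucc, ← sub_mul, abs_mul]
        have h1 := ih r hr'
        rw [Fin.val_succ, Nat.add_sub_add_right] at h1
        exact mul_le_mul h1 (abs_deriv_x_le γ r) (abs_nonneg _) (pow_nonneg hε _)
  have h := key b ⟨hab, le_rfl⟩
  have hb : y i b = y i a := by simp only [y, hx]
  rwa [hb, hy] at h

theorem abs_u_sub_le_of_edist_lt {p q : JetSpace k} {ε : ℝ} (hx : p.x = q.x) (hε : 0 ≤ ε)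
    (h : edist p q < ENNReal.ofReal ε) (i : Fin (k + 1)) :
    |p.u i - q.u i| ≤ ε ^ (k + 1 - (i : ℕ)) := by
  obtain ⟨γ, a, b, hab, hγ, rfl, rfl, hl⟩ := exists_of_ccDist_lt h
  rw [abs_sub_comm]
  exact abs_u_sub_le_of_length_le hab hγ hx.symm hε hl.le i

/-! ### Jets of functions and the upper bound for the distance in a vertical plane -/

/-- The `k`-jet of a function at a point. -/
noncomputable def jet (k : ℕ) (f : ℝ → ℝ) (s : ℝ) : JetSpace k :=
  ⟨s, fun j => iteratedDeriv j f s⟩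

/-- The curve of the jets of a function is horizontal, and its speed is controlled by the
derivative of order `k + 1`. -/
theorem edist_jet_le {f : ℝ → ℝ} (hf : ContDiff ℝ (⊤ : ℕ∞) f) {a b M : ℝ} (hab : a ≤ b)
    (hM : ∀ s ∈ Set.Icc a b, |iteratedDeriv (k + 1) f s| ≤ M) :
    edist (jet k f a) (jet k f b) ≤ ENNReal.ofReal ((1 + M) * (b - a)) := by
  have hM0 : 0 ≤ M := (abs_nonneg _).trans (hM a ⟨le_rfl, hab⟩)
  have hsm : ∀ n : ℕ, ContDiff ℝ 1 (iteratedDeriv n f) := fun n =>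
    iteratedDeriv_eq_iterate (f := f) ▸ ContDiff.iterate_deriv' 1 n
      (hf.of_le (by exact_mod_cast le_top))
  have hh : IsHorizontal (jet k f) a b := by
    refine ⟨contDiffOn_id.absolutelyContinuousOnInterval,
      fun j => (hsm j).contDiffOn.absolutelyContinuousOnInterval, fun j => .of_forall fun s => ?_⟩
    simp [jet, iteratedDeriv_succ]
  refine (ccDist_le hab hh).trans ?_
  calc length (jet k f) a b ≤ ∫⁻ _ in Set.Icc a b, ENNReal.ofReal (1 + M) := by
        refine MeasureTheory.setLIntegral_mono measurable_const fun s hs => ?_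
        refine ENNReal.ofReal_le_ofReal ?_
        have h1 : deriv (fun r => (jet k f r).u (Fin.last k)) s = iteratedDeriv (k + 1) f s := by
          simp [jet, iteratedDeriv_succ]
        have h2 : deriv (fun r => (jet k f r).x) s = 1 := by simp [jet]
        rw [speed, h1, h2]
        refine Real.sqrt_le_iff.2 ⟨by positivity, ?_⟩
        have := sq_le_sq' (abs_le.1 (hM s hs)).1 (abs_le.1 (hM s hs)).2
        nlinarith
    _ = ENNReal.ofReal ((1 + M) * (b - a)) := by
        rw [MeasureTheory.setLIntegral_const, Real.volume_Icc, ENNReal.ofReal_mul (by positivity)]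

theorem iteratedDeriv_polynomial (P : Polynomial ℝ) (n : ℕ) :
    iteratedDeriv n (fun x => P.eval x) = fun x => (Polynomial.derivative^[n] P).eval x := by
  induction n with
  | zero => simp
  | succ n ih =>
    rw [iteratedDeriv_succ, ih, Function.iterate_succ_apply']
    ext x
    exact Polynomial.deriv _

theorem exists_contDiff_iteratedDeriv_eq (i : ℕ) : ∃ φ : ℝ → ℝ, ContDiff ℝ (⊤ : ℕ∞) φ ∧
    (∀ n, iteratedDeriv n φ 0 = if n = i then 1 else 0) ∧ ∀ n, iteratedDeriv n φ 1 = 0 := by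
  -- `x ^ i / i!` cut off by a function that is `1` for `x ≤ 1 / 3` and `0` for `x ≥ 2 / 3`
  refine ⟨fun x => (i.factorial : ℝ)⁻¹ * x ^ i * Real.smoothTransition (2 - 3 * x), ?_, ?_, ?_⟩
  · refine ContDiff.mul (by fun_prop) (Real.smoothTransition.contDiff.comp (by fun_prop))
  · intro n
    have h : (fun x : ℝ => (i.factorial : ℝ)⁻¹ * x ^ i * Real.smoothTransition (2 - 3 * x))
        =ᶠ[nhds 0] fun x => (i.factorial : ℝ)⁻¹ * x ^ i := by
      filter_upwards [gt_mem_nhds (by norm_num : (0 : ℝ) < 1 / 3)] with x hx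
      rw [Real.smoothTransition.one_of_one_le (by linarith), mul_one]
    rw [h.iteratedDeriv_eq, iteratedDeriv_const_mul_field, iteratedDeriv_fun_pow_zero]
    split_ifs <;> simp [Nat.factorial_ne_zero]
  · intro n
    have h : (fun x : ℝ => (i.factorial : ℝ)⁻¹ * x ^ i * Real.smoothTransition (2 - 3 * x))
        =ᶠ[nhds 1] fun _ => 0 := by
      filter_upwards [lt_mem_nhds (by norm_num : (2 / 3 : ℝ) < 1)] with x hx
      rw [Real.smoothTransition.zero_of_nonpos (by linarith), mul_zero]
    rw [h.iteratedDeriv_eq, iteratedDeriv_fun_const_zero]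

/-- A jet `v` of size adapted to the scale `ε` is joined to the zero jet within an interval of
length `ε` by a function whose derivative of order `k + 1` is bounded independently of `ε`. -/
theorem exists_contDiff_jet_eq (k : ℕ) : ∃ C : ℝ, 0 ≤ C ∧
    ∀ (t ε : ℝ) (v : Fin (k + 1) → ℝ), 0 < ε → (∀ i, |v i| ≤ ε ^ (k + 1 - (i : ℕ))) →
      ∃ f : ℝ → ℝ, ContDiff ℝ (⊤ : ℕ∞) f ∧ (∀ i : Fin (k + 1), iteratedDeriv i f t = v i) ∧
        (∀ n, iteratedDeriv n f (t + ε) = 0) ∧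
        ∀ s ∈ Set.Icc t (t + ε), |iteratedDeriv (k + 1) f s| ≤ C := by
  choose φ hφ h0 h1 using exists_contDiff_iteratedDeriv_eq
  have hB : ∀ i, ∃ B, ∀ x ∈ Set.Icc (0 : ℝ) 1, ‖iteratedDeriv (k + 1) (φ i) x‖ ≤ B := fun i =>
    isCompact_Icc.exists_bound_of_continuousOn
      ((hφ i).continuous_iteratedDeriv _ (by exact_mod_cast le_top)).continuousOn
  choose B hB using hB
  have hB0 : ∀ i, 0 ≤ B i := fun i => (norm_nonneg _).trans (hB i 0 (by simp))
  refine ⟨∑ i : Fin (k + 1), B i, Finset.sum_nonneg fun i _ => hB0 i, fun t ε v hε hv => ?_⟩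
  let f : ℝ → ℝ := fun x => ∑ i : Fin (k + 1), v i * ε ^ (i : ℕ) * φ i (ε⁻¹ * (x - t))
  have hcd : ∀ i, ContDiff ℝ (⊤ : ℕ∞) fun x => φ i (ε⁻¹ * (x - t)) := fun i =>
    (hφ i).comp (by fun_prop)
  have hf : ∀ n x, iteratedDeriv n f x = ∑ i : Fin (k + 1),
      v i * ε ^ (i : ℕ) * (ε⁻¹ ^ n * iteratedDeriv n (φ i) (ε⁻¹ * (x - t))) := by
    intro n x
    have hle : (n : WithTop ℕ∞) ≤ (⊤ : ℕ∞) := by exact_mod_cast le_top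
    refine (iteratedDeriv_fun_sum
      (f := fun (i : Fin (k + 1)) z => v i * ε ^ (i : ℕ) * φ i (ε⁻¹ * (z - t))) fun i _ =>
      (contDiff_const.mul ((hcd i).of_le hle)).contDiffAt).trans ?_
    refine Finset.sum_congr rfl fun i _ => ?_
    rw [iteratedDeriv_const_mul_field,
      iteratedDeriv_comp_sub_const n (fun z => φ i (ε⁻¹ * z)) t,
      iteratedDeriv_comp_const_mul ((hφ i).of_le hle)]
  refine ⟨f, ContDiff.sum fun i _ => contDiff_const.mul (hcd i), fun j => ?_, fun n => ?_,
    fun s hs => ?_⟩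
  · rw [hf, Finset.sum_eq_single j]
    · rw [sub_self, mul_zero, h0, if_pos rfl, mul_one, mul_assoc, ← mul_pow,
        mul_inv_cancel₀ hε.ne', one_pow, mul_one]
    · intro i _ hij
      rw [sub_self, mul_zero, h0, if_neg (Fin.val_ne_of_ne hij.symm), mul_zero, mul_zero]
    · simp
  · rw [hf]
    refine Finset.sum_eq_zero fun i _ => ?_
    rw [add_sub_cancel_left, inv_mul_cancel₀ hε.ne', h1, mul_zero, mul_zero]
  · rw [hf]
    refine (Finset.abs_sum_le_sum_abs _ _).trans (Finset.sum_le_sum fun i _ => ?_)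
    have hs' : ε⁻¹ * (s - t) ∈ Set.Icc (0 : ℝ) 1 := by
      rw [← div_eq_inv_mul]
      exact ⟨div_nonneg (by linarith [hs.1]) hε.le, (div_le_one hε).2 (by linarith [hs.2])⟩
    have e : ε ^ (k + 1 - (i : ℕ)) * ε ^ (i : ℕ) * ε⁻¹ ^ (k + 1) = 1 := by
      rw [← pow_add, Nat.sub_add_cancel i.2.le, ← mul_pow, mul_inv_cancel₀ hε.ne', one_pow]
    calc |v i * ε ^ (i : ℕ) * (ε⁻¹ ^ (k + 1) * iteratedDeriv (k + 1) (φ i) (ε⁻¹ * (s - t)))|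
        = |v i| * ε ^ (i : ℕ) * ε⁻¹ ^ (k + 1) *
            |iteratedDeriv (k + 1) (φ i) (ε⁻¹ * (s - t))| := by
          rw [abs_mul, abs_mul, abs_mul, abs_of_pos (pow_pos hε _),
            abs_of_pos (pow_pos (inv_pos.2 hε) _)]
          ring
      _ ≤ ε ^ (k + 1 - (i : ℕ)) * ε ^ (i : ℕ) * ε⁻¹ ^ (k + 1) * B i := by
          have := hB i _ hs'
          rw [Real.norm_eq_abs] at this
          have := hv i
          gcongr
      _ = B i := by rw [e, one_mul]

/-- Go from `p` to a point of `{x = t + ε}` along the jet of one function and back to `q` along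
the jet of a polynomial of degree at most `k`. -/
theorem exists_edist_le (k : ℕ) : ∃ C : ℝ, 0 < C ∧ ∀ (p q : JetSpace k) (ε : ℝ), p.x = q.x →
    0 < ε → (∀ i, |p.u i - q.u i| ≤ ε ^ (k + 1 - (i : ℕ))) →
      edist p q ≤ ENNReal.ofReal (C * ε) := by
  obtain ⟨C, hC, H⟩ := exists_contDiff_jet_eq k
  refine ⟨C + 2, by positivity, fun p q ε hx hε hpq => ?_⟩
  obtain ⟨f, hf, hft, hfε, hfC⟩ := H q.x ε (fun i => p.u i - q.u i) hε hpq
  set P := taylorPoly q.x q.u with hP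
  have hPs : ContDiff ℝ (⊤ : ℕ∞) fun x => P.eval x := by
    simpa using P.contDiff_aeval (𝕜 := ℝ) (R := ℝ) (⊤ : ℕ∞)
  have hP0 : ∀ s, iteratedDeriv (k + 1) (fun x => P.eval x) s = 0 := fun s => by
    simp only [iteratedDeriv_polynomial, hP, iterate_derivative_taylorPoly_eq_zero,
      Polynomial.eval_zero]
  have hadd : ∀ n s, iteratedDeriv n (fun x => f x + P.eval x) s =
      iteratedDeriv n f s + iteratedDeriv n (fun x => P.eval x) s := fun n s => by
    have hle : (n : WithTop ℕ∞) ≤ (⊤ : ℕ∞) := by exact_mod_cast le_top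
    exact iteratedDeriv_fun_add (hf.of_le hle).contDiffAt (hPs.of_le hle).contDiffAt
  have hjq : jet k (fun x => P.eval x) q.x = q := by
    ext i
    · rfl
    · simp only [jet, iteratedDeriv_polynomial]
      exact eval_iterate_derivative_taylorPoly _ _ i
  have hjp : jet k (fun x => f x + P.eval x) q.x = p := by
    ext i
    · exact hx.symm
    · have h := congrArg (fun r : JetSpace k => r.u i) hjq
      simp only [jet] at h
      simp only [jet, hadd, hft, h, sub_add_cancel]
  have hjε : jet k (fun x => f x + P.eval x) (q.x + ε) = jet k (fun x => P.eval x) (q.x + ε) := by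
    ext i
    · rfl
    · simp only [jet, hadd, hfε, zero_add]
  have h1 := edist_jet_le (k := k) (hf.add hPs) (by linarith : q.x ≤ q.x + ε) (M := C)
    fun s hs => by rw [hadd, hP0, add_zero]; exact hfC s hs
  have h2 := edist_jet_le (k := k) hPs (by linarith : q.x ≤ q.x + ε) (M := 0)
    fun s _ => by rw [hP0, abs_zero]
  rw [hjp, hjε] at h1
  rw [hjq, edist_comm] at h2
  refine (edist_triangle _ _ _).trans ((add_le_add h1 h2).trans_eq ?_)
  rw [add_sub_cancel_left, ← ENNReal.ofReal_add (by positivity) (by positivity)]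
  congr 1
  ring

/-- In a vertical plane the Carnot–Carathéodory distance is comparable to the maximum of
`|p.u i - q.u i| ^ (1 / (k + 1 - i))`. -/
theorem hasWeights_mk (k : ℕ) (t : ℝ) :
    HasWeights (fun u : Fin (k + 1) → ℝ => (⟨t, u⟩ : JetSpace k)) fun i => k + 1 - (i : ℕ) where
  one_le i := by omega
  abs_sub_le_pow u v _ hε h i :=
    abs_u_sub_le_of_edist_lt (p := ⟨t, u⟩) (q := ⟨t, v⟩) rfl hε.le h i
  edist_le := by
    obtain ⟨C, hC, H⟩ := exists_edist_le k
    exact ⟨C, hC, fun u v ε hε h => H ⟨t, u⟩ ⟨t, v⟩ ε rfl hε h⟩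

/-! ### Boxes of prescribed dimension -/

/-- The factor of `verticalBox k t j F` in the coordinate of weight `m`. -/
noncomputable def boxFactor (j : ℕ) (F : Set ℝ) (m : ℕ) : Set ℝ :=
  if m < j then Set.Icc 0 1 else if m = j then F else {0}

theorem verticalBox_eq_image (k : ℕ) (t : ℝ) (j : ℕ) (F : Set ℝ) :
    verticalBox k t j F = (fun u : Fin (k + 1) → ℝ => (⟨t, u⟩ : JetSpace k)) ''
      Set.univ.pi fun i => boxFactor j F (k + 1 - (i : ℕ)) := by
  have hfac : ∀ (m : ℕ) (y : ℝ), ((m < j → y ∈ Set.Icc (0 : ℝ) 1) ∧ (m = j → y ∈ F) ∧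
      (j < m → y = 0)) ↔ y ∈ boxFactor j F m := by
    intro m y
    rw [boxFactor]
    rcases lt_trichotomy m j with h | h | h
    · simp [h, h.ne, h.not_gt]
    · simp [h]
    · simp [h, h.ne', h.not_gt]
  ext p
  simp only [verticalBox, Set.mem_ofPred_eq, hfac, Set.mem_image, Set.mem_univ_pi]
  constructor
  · rintro ⟨rfl, h⟩
    exact ⟨p.u, h, rfl⟩
  · rintro ⟨u, hu, rfl⟩
    exact ⟨rfl, hu⟩

/-- The homogeneous dimension of `verticalBox k t j F` when `F` has dimension `s`. -/
theorem sum_weight_mul_dim {k j : ℕ} (hj1 : 1 ≤ j) (hj : j ≤ k + 1) (s : ℝ) :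
    ∑ i : Fin (k + 1), ((k + 1 - (i : ℕ) : ℕ) : ℝ) *
      (if k + 1 - (i : ℕ) < j then 1 else if k + 1 - (i : ℕ) = j then s else 0) =
        (j : ℝ) * (j - 1) / 2 + j * s := by
  let g : ℕ → ℝ := fun m => (m : ℝ) * (if m < j then 1 else if m = j then s else 0)
  have h1 : ∑ i : Fin (k + 1), g (k + 1 - (i : ℕ)) = ∑ m ∈ Finset.range (k + 1), g (m + 1) := by
    rw [Fin.sum_univ_eq_sum_range fun i => g (k + 1 - i), ← Finset.sum_range_reflect]
    refine Finset.sum_congr rfl fun m hm => ?_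
    rw [Finset.mem_range] at hm
    congr 1
    omega
  have h2 : ∀ n, ∑ m ∈ Finset.range n, g (m + 1) =
      if n < j then (n : ℝ) * (n + 1) / 2 else (j : ℝ) * (j - 1) / 2 + j * s := by
    intro n
    induction n with
    | zero => rw [if_pos (by omega)]; simp
    | succ n ih =>
      rw [Finset.sum_range_succ, ih]
      simp only [g]
      rcases lt_trichotomy (n + 1) j with h | h | h
      · rw [if_pos (by omega), if_pos h, if_pos h]
        push_cast
        ring
      · subst h
        rw [if_pos (by omega), if_neg (by omega), if_pos rfl, if_neg (by omega)]
        push_cast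
        ring
      · rw [if_neg (by omega), if_neg (by omega), if_neg (by omega), if_neg (by omega)]
        ring
  refine h1.trans ((h2 _).trans (if_neg (by omega)))

theorem isCompact_verticalBox_and_dimH {k j : ℕ} (hj1 : 1 ≤ j) (hj : j ≤ k + 1) (t : ℝ)
    {F : Set ℝ} {s : ℝ} (hF : IsRegularSet F s) :
    IsCompact (verticalBox k t j F) ∧
      dimH (verticalBox k t j F) = ENNReal.ofReal ((j : ℝ) * (j - 1) / 2 + j * s) := by
  have hfac : ∀ m,
      IsRegularSet (boxFactor j F m) (if m < j then 1 else if m = j then s else 0) := by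
    intro m
    rw [boxFactor]
    split_ifs
    exacts [isRegularSet_Icc, hF, isRegularSet_singleton 0]
  rw [verticalBox_eq_image]
  refine ⟨(isCompact_univ_pi fun i => (hfac _).isCompact).image (hasWeights_mk k t).continuous, ?_⟩
  rw [(hasWeights_mk k t).dimH_image fun i => hfac _, sum_weight_mul_dim hj1 hj]

theorem exists_eq_triangular_add {k : ℕ} {β : ℝ} (h0 : 0 ≤ β)
    (hβ : β ≤ ((k : ℝ) + 1) * ((k : ℝ) + 2) / 2) : ∃ (j : ℕ) (s : ℝ), 1 ≤ j ∧ j ≤ k + 1 ∧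
      0 ≤ s ∧ s ≤ 1 ∧ (j : ℝ) * (j - 1) / 2 + j * s = β := by
  induction k with
  | zero => exact ⟨1, β, le_rfl, le_rfl, h0, by norm_num at hβ; linarith, by norm_num⟩
  | succ k ih =>
    rcases le_total β (((k : ℝ) + 1) * ((k : ℝ) + 2) / 2) with h | h
    · obtain ⟨j, s, h1, h2, h3⟩ := ih h
      exact ⟨j, s, h1, by omega, h3⟩
    · have hk : (0 : ℝ) < (k : ℝ) + 2 := by positivity
      push_cast at hβ
      refine ⟨k + 2, (β - ((k : ℝ) + 1) * ((k : ℝ) + 2) / 2) / (k + 2), by omega, le_rfl,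
        div_nonneg (by linarith) hk.le, (div_le_one hk).2 (by linarith), ?_⟩
      push_cast
      field_simp
      ring

end JetSpace

theorem mainTheorem2 (k : ℕ) (hk : 1 ≤ k) (t β : ℝ) (hβ₀ : 0 ≤ β)
    (hβ : β ≤ ((k : ℝ) + 1) * ((k : ℝ) + 2) / 2) :
    ∃ E : Set (JetSpace k), IsCompact E ∧ E ⊆ JetSpace.verticalPlane k t ∧
      dimH E = ENNReal.ofReal β ∧
      ∃ (j : ℕ) (F : Set ℝ), 1 ≤ j ∧ j ≤ k + 1 ∧ IsCompact F ∧
        ENNReal.ofReal ((j : ℝ) * ((j : ℝ) - 1) / 2) + (j : ℝ≥0∞) * dimH F = ENNReal.ofReal β ∧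
        E = JetSpace.verticalBox k t j F := by
  obtain ⟨j, s, hj1, hj, hs0, hs1, hjs⟩ := JetSpace.exists_eq_triangular_add hβ₀ hβ
  obtain ⟨F, hF⟩ := exists_isRegularSet hs0 hs1
  obtain ⟨hc, hd⟩ := JetSpace.isCompact_verticalBox_and_dimH hj1 hj t hF
  refine ⟨_, hc, fun p hp => hp.1, by rw [hd, hjs], j, F, hj1, hj, hF.isCompact, ?_, rfl⟩
  have hj' : (1 : ℝ) ≤ j := by exact_mod_cast hj1
  rw [hF.dimH_eq, ← hjs, ENNReal.ofReal_add (by nlinarith) (by positivity),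
    ENNReal.ofReal_mul (Nat.cast_nonneg _), ENNReal.ofReal_natCast]
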